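/- An undirected graph with legs consists of finite sets $E$ (edges) and $V$ (vertices) and a function $\mathrm{nbhd}\colon V\to\mathcal P(E)$ such that every edge lies in $\mathrm{nbhd}(v)$ for at most two vertices $v$. An edge is interior if it lies in $\mathrm{nbhd}(v)\cap\mathrm{nbhd}(w)$ for some $v\neq w$, and otherwise it is a leg. A tree $S$ is an undirected graph with legs that is contractible (its incidence graph, with node set $V\sqcup E$ and $v$ joined to $e$ when $e\in\mathrm{nbhd}(v)$, is a tree) and has at least one leg, together with bijections $\mathrm{ord}^v\colon\{0,\dots,n_v\}\to\mathrm{nbhd}(v)$ for every vertex $v$ and a map $\mathrm{ord}\colon\{0,\dots,n\}\to\mathrm{legs}(S)$ which is a bijection if $S$ has a vertex and is the unique map from $\{0,1\}$ to the single edge otherwise. A subgraph of $S$ is a pair of subsets $V'\subseteq V$, $E'\subseteq E$ with $\mathrm{nbhd}(v)\subseteq E'$ for all $v\in V'$ such that $(V',E',\mathrm{nbhd})$ is contractible (in particular non-empty). For example, each edge $e$ gives a subgraph $|_e$ without vertices, and each vertex $v$ gives the subgraph $\star_v=(\{v\},\mathrm{nbhd}(v))$. The boundary $\eth(T)$ of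 a subgraph $T$ is the unordered list of edges $e^2$ if $T=|_e$, and otherwise the list of the legs of $T$, each once. Two subgraphs overlap if they have a vertex or an edge in common; then their intersection and union are subgraphs. Let $\Xi$ be the category whose objects are trees and whose morphisms $\phi\colon R\to S$ are pairs consisting of a function $\phi_0$ from the edges of $R$ to those of $S$ and a function $\phi_1$ from the subgraphs of $R$ to those of $S$ such that $\eth(\phi_1(T))=\phi_0(\eth(T))$ for every subgraph $T$ of $R$, and such that, whenever $T,T'$ overlap, so do $\phi_1(T),\phi_1(T')$, and $\phi_1(T\cap T')=\phi_1(T)\cap\phi_1(T')$, $\phi_1(T\cup T')=\phi_1(T)\cup\phi_1(T')$. Composition is composition of functions. Write $\phi_1(v)=\phi_1(\star_v)$ for a vertex $v$. Let $d(S)$ be the number of vertices of $S$. Let $\Xi^+$ consist of the maps $\phi$ with $\phi_0$ injective, and let $\Xi^-$ consist of the maps $\phi\colon R\to S$ such that $\phi_0$ is surjective and every vertex of $S$ is a vertex of $\phi_1(w)$ for some vertex $w$ of $R$. **Proposition.** The category $\Xi$ is (essentially) small, and $(\Xi^+,\Xi^-,d)$ is a dualizable generalized Reedy structure on it. That is,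 $\Xi^+$ and $\Xi^-$ are wide subcategories, and: (i) non-invertible morphisms in $\Xi^+$ (resp. $\Xi^-$) strictly raise (resp. lower) the degree $d$, and isomorphisms preserve it; (ii) $\Xi^+\cap\Xi^-$ is the class of all isomorphisms of $\Xi$; (iii) every morphism $f$ factors as $f=gh$ with $g\in\Xi^+$ and $h\in\Xi^-$, and if $f=g'h'$ is another such factorization, then there is an isomorphism $\theta$ with $\theta h=h'$ and $g=g'\theta$; (iv) if $\theta f=f$ with $\theta$ an isomorphism and $f\in\Xi^-$, then $\theta$ is an identity; (iv') if $f\theta=f$ with $\theta$ an isomorphism and $f\in\Xi^+$, then $\theta$ is an identity. -/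

import Mathlib

open CategoryTheory

universe u

/-- An undirected graph with legs: finite sets of edges and vertices, and for each vertex the set of
edges incident to it, every edge being incident to at most two vertices. -/
structure LegGraph where
  Edge : Type u
  Vert : Type u
  finite_edge : Finite Edge
  finite_vert : Finite Vert
  nbhd : Vert → Set Edge
  ncard_le_two : ∀ e : Edge, {v : Vert | e ∈ nbhd v}.ncard ≤ 2

namespace LegGraph

attribute [instance] LegGraph.finite_edge LegGraph.finite_vert

/-- Interior edges: those incident to two distinct vertices. -/
def interior (G : LegGraph.{u}) : Set G.Edge :=
  {e | ∃ v w : G.Vert, v ≠ w ∧ e ∈ G.nbhd v ∧ e ∈ G.nbhd w}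

/-- Legs: edges which are not interior. -/
def legs (G : LegGraph.{u}) : Set G.Edge := G.interiorᶜ

/-- The incidence graph: its nodes are the vertices and the edges of `G`, and a vertex `v` is joined
to an edge `e` exactly when `e ∈ nbhd v`. -/
def incidence (G : LegGraph.{u}) : SimpleGraph (G.Vert ⊕ G.Edge) where
  Adj
    | .inl v, .inr e => e ∈ G.nbhd v
    | .inr e, .inl v => e ∈ G.nbhd v
    | _, _ => False
  symm := ⟨by rintro (v | e) (w | f) h <;> exact h⟩
  loopless := ⟨by rintro (v | e) h <;> exact h⟩

end LegGraph

/-- The objects of `Ξ`: (pinned) trees. The space of a finite graph with legs deformation retracts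
onto the realization of its incidence graph, so it is contractible exactly when the incidence graph
is a tree (connected and acyclic). -/
structure Xi extends LegGraph.{u} where
  contractible : toLegGraph.incidence.IsTree
  exists_leg : toLegGraph.legs.Nonempty
  /-- `valence v + 1` is the number of edges at `v`. -/
  valence : Vert → ℕ
  /-- The ordering of the neighbourhood of each vertex. -/
  ordAt : ∀ v : Vert, Fin (valence v + 1) ≃ nbhd v
  numLegs : ℕ
  /-- The ordering of the legs: a bijection if there is a vertex, and otherwise the unique map from
  a two-element set to the single edge. -/
  ord : Fin (numLegs + 1) → toLegGraph.legs
  ord_bijective : Nonempty Vert → Function.Bijective ord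
  numLegs_of_isEmpty : IsEmpty Vert → numLegs = 1

namespace Xi

/-- The nodes of the incidence graph that belong to a set of vertices and a set of edges. -/
def nodes {S : Xi.{u}} (V : Set S.Vert) (E : Set S.Edge) : Set (S.Vert ⊕ S.Edge) :=
  Sum.inl '' V ∪ Sum.inr '' E

/-- A subgraph of a tree `S`: a set of vertices and a set of edges containing all edges incident to
these vertices, such that the graph formed by them is contractible. (The incidence graph of that
graph is the one induced from the incidence graph of `S`.) -/
@[ext]
structure Subgraph (S : Xi.{u}) where
  verts : Set S.Vert
  edges : Set S.Edge
  nbhd_subset : ∀ v ∈ verts, S.nbhd v ⊆ edges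
  contractible : (S.incidence.induce (nodes verts edges)).IsTree

namespace Subgraph

variable {S : Xi.{u}}

/-- The legs of a subgraph: its edges that are not incident to two distinct vertices of it. -/
def legs (T : Subgraph S) : Set S.Edge :=
  {e ∈ T.edges | ¬ ∃ v ∈ T.verts, ∃ w ∈ T.verts, v ≠ w ∧ e ∈ S.nbhd v ∧ e ∈ S.nbhd w}

open Classical in
/-- The boundary of a subgraph, an unordered list of edges (an element of the free commutative
monoid on the edges): `e, e` for the subgraph consisting of a single edge `e` and no vertex, and
the list of the legs, each once, otherwise. -/
noncomputable def boundary (T : Subgraph S) : Multiset S.Edge :=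
  if T.verts = ∅ then T.edges.toFinite.toFinset.val + T.edges.toFinite.toFinset.val
  else T.legs.toFinite.toFinset.val

/-- Two subgraphs overlap if they have a vertex or an edge in common. -/
def Overlap (T T' : Subgraph S) : Prop :=
  (T.verts ∩ T'.verts).Nonempty ∨ (T.edges ∩ T'.edges).Nonempty

theorem isTree_of_preconnected {s : Set (S.Vert ⊕ S.Edge)} (hs : s.Nonempty)
    (h : (S.incidence.induce s).Preconnected) : (S.incidence.induce s).IsTree := by
  have : Nonempty s := hs.to_subtype
  exact ⟨⟨h⟩, S.contractible.isAcyclic.induce s⟩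

theorem preconnected_inter {s t : Set (S.Vert ⊕ S.Edge)}
    (hs : (S.incidence.induce s).Preconnected) (ht : (S.incidence.induce t).Preconnected) :
    (S.incidence.induce (s ∩ t)).Preconnected := by
  classical
  rintro ⟨x, hxs, hxt⟩ ⟨y, hys, hyt⟩
  obtain ⟨p, hp⟩ := (hs ⟨x, hxs⟩ ⟨y, hys⟩).exists_isPath
  obtain ⟨q, hq⟩ := (ht ⟨x, hxt⟩ ⟨y, hyt⟩).exists_isPath
  let P := p.map (SimpleGraph.Embedding.induce s).toHom
  let Q := q.map (SimpleGraph.Embedding.induce t).toHom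
  have hP : P.IsPath := hp.map Subtype.val_injective
  have hQ : Q.IsPath := hq.map Subtype.val_injective
  have hPQ : P = Q := congrArg Subtype.val
    ((S.contractible.isAcyclic.subsingleton_path x y).elim ⟨P, hP⟩ ⟨Q, hQ⟩)
  have h : ∀ z ∈ P.support, z ∈ s ∩ t := by
    intro z hz
    refine ⟨?_, ?_⟩
    · obtain ⟨a, -, rfl⟩ := List.mem_map.1 ((SimpleGraph.Walk.support_map _ p) ▸ hz)
      exact a.2
    · rw [hPQ] at hz
      obtain ⟨a, -, rfl⟩ := List.mem_map.1 ((SimpleGraph.Walk.support_map _ q) ▸ hz)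
      exact a.2
  exact ⟨P.induce _ h⟩

theorem nodes_inter (V V' : Set S.Vert) (E E' : Set S.Edge) :
    nodes (V ∩ V') (E ∩ E') = nodes V E ∩ nodes V' E' := by
  ext (v | e) <;> simp [nodes]

theorem nodes_union (V V' : Set S.Vert) (E E' : Set S.Edge) :
    nodes (V ∪ V') (E ∪ E') = nodes V E ∪ nodes V' E' := by
  ext (v | e) <;> simp [nodes]

theorem Overlap.nonempty {T T' : Subgraph S} (h : T.Overlap T') :
    (nodes T.verts T.edges ∩ nodes T'.verts T'.edges).Nonempty := by
  rw [← nodes_inter]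
  rcases h with ⟨v, hv⟩ | ⟨e, he⟩
  · exact ⟨.inl v, by simpa [nodes] using hv⟩
  · exact ⟨.inr e, by simpa [nodes] using he⟩

/-- The intersection of two overlapping subgraphs. -/
def inter (T T' : Subgraph S) (h : T.Overlap T') : Subgraph S where
  verts := T.verts ∩ T'.verts
  edges := T.edges ∩ T'.edges
  nbhd_subset v hv := Set.subset_inter (T.nbhd_subset v hv.1) (T'.nbhd_subset v hv.2)
  contractible := by
    rw [nodes_inter]
    exact isTree_of_preconnected h.nonempty (preconnected_inter
      T.contractible.connected.preconnected T'.contractible.connected.preconnected)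

/-- The union of two overlapping subgraphs. -/
def union (T T' : Subgraph S) (h : T.Overlap T') : Subgraph S where
  verts := T.verts ∪ T'.verts
  edges := T.edges ∪ T'.edges
  nbhd_subset v hv := hv.elim
    (fun hv => (T.nbhd_subset v hv).trans Set.subset_union_left)
    (fun hv => (T'.nbhd_subset v hv).trans Set.subset_union_right)
  contractible := by
    rw [nodes_union]
    exact isTree_of_preconnected (h.nonempty.mono (fun _ hx => Or.inl hx.1))
      (SimpleGraph.induce_union_connected T.contractible.connected.preconnected
        T'.contractible.connected.preconnected h.nonempty).preconnected

/-- The subgraph consisting of a vertex and the edges incident to it. -/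
def star (v : S.Vert) : Subgraph S where
  verts := {v}
  edges := S.nbhd v
  nbhd_subset w hw := by rw [Set.mem_singleton_iff.1 hw]
  contractible := by
    have hv : (Sum.inl v : S.Vert ⊕ S.Edge) ∈ nodes {v} (S.nbhd v) := by simp [nodes]
    have key : ∀ x : nodes {v} (S.nbhd v),
        (S.incidence.induce (nodes {v} (S.nbhd v))).Reachable ⟨_, hv⟩ x := by
      rintro ⟨w | e, hx⟩
      · obtain rfl : w = v := by simpa [nodes] using hx
        exact SimpleGraph.Reachable.refl _
      · exact SimpleGraph.Adj.reachable
          (show e ∈ S.nbhd v by simpa [nodes] using hx)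
    exact isTree_of_preconnected ⟨_, hv⟩ fun x y => (key x).symm.trans (key y)

end Subgraph

/-- Morphisms of `Ξ` (complete morphisms): a map on edges and a map on subgraphs, compatible with
boundaries and with intersections and unions of overlapping subgraphs. -/
@[ext]
structure Hom (R S : Xi.{u}) where
  onEdge : R.Edge → S.Edge
  onSub : Subgraph R → Subgraph S
  boundary_onSub : ∀ T, (onSub T).boundary = T.boundary.map onEdge
  overlap : ∀ {T T'}, T.Overlap T' → (onSub T).Overlap (onSub T')
  inter : ∀ T T' (h : T.Overlap T'),
    onSub (T.inter T' h) = (onSub T).inter (onSub T') (overlap h)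
  union : ∀ T T' (h : T.Overlap T'),
    onSub (T.union T' h) = (onSub T).union (onSub T') (overlap h)

/-- The category `Ξ`; composition is composition of functions. -/
instance : Category.{u} Xi.{u} where
  Hom := Hom
  id R :=
    { onEdge := id
      onSub := id
      boundary_onSub := fun T => by simp
      overlap := fun h => h
      inter := fun _ _ _ => rfl
      union := fun _ _ _ => rfl }
  comp f g :=
    { onEdge := g.onEdge ∘ f.onEdge
      onSub := g.onSub ∘ f.onSub
      boundary_onSub := fun T => by
        simp [g.boundary_onSub, f.boundary_onSub, Multiset.map_map]
      overlap := fun h => g.overlap (f.overlap h)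
      inter := fun T T' h => by simp [f.inter _ _ h, g.inter _ _ (f.overlap h)]
      union := fun T T' h => by simp [f.union _ _ h, g.union _ _ (f.overlap h)] }

/-- The value of a morphism at a vertex: its value at the star of the vertex. -/
def Hom.onVert {R S : Xi.{u}} (f : Hom R S) (v : R.Vert) : Subgraph S :=
  f.onSub (Subgraph.star v)

/-- The number of vertices of a tree. -/
noncomputable def degree (S : Xi.{u}) : ℕ := Nat.card S.Vert

/-- The maps that are injective on edges. -/
def plus : MorphismProperty Xi.{u} := fun _ _ f => Function.Injective (Hom.onEdge f)

/-- The maps that are surjective on edges and hit every vertex. -/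
def minus : MorphismProperty Xi.{u} := fun R S f =>
  Function.Surjective (Hom.onEdge f) ∧
    ∀ v : S.Vert, ∃ w : R.Vert, v ∈ (Hom.onVert f w).verts

end Xi

/-- The classes of morphisms `P` (for `ℝ⁺`) and `M` (for `ℝ⁻`) and the degree function `d` form a
generalized Reedy structure on `C`. -/
structure IsGeneralizedReedy {C : Type*} [Category C] (P M : MorphismProperty C) (d : C → ℕ) :
    Prop where
  /-- `P` and `M` are wide subcategories. -/
  plus_wide : P.IsMultiplicative
  minus_wide : M.IsMultiplicative
  degree_lt_of_plus : ∀ {X Y : C} (f : X ⟶ Y), P f → ¬ IsIso f → d X < d Y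
  degree_lt_of_minus : ∀ {X Y : C} (f : X ⟶ Y), M f → ¬ IsIso f → d Y < d X
  degree_eq_of_isIso : ∀ {X Y : C} (f : X ⟶ Y), IsIso f → d X = d Y
  plus_and_minus_iff : ∀ {X Y : C} (f : X ⟶ Y), (P f ∧ M f) ↔ IsIso f
  exists_factorization : ∀ {X Y : C} (f : X ⟶ Y),
    ∃ (Z : C) (h : X ⟶ Z) (g : Z ⟶ Y), M h ∧ P g ∧ h ≫ g = f
  factorization_unique : ∀ {X Y Z Z' : C} (h : X ⟶ Z) (g : Z ⟶ Y) (h' : X ⟶ Z') (g' : Z' ⟶ Y),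
    M h → P g → M h' → P g' → h ≫ g = h' ≫ g' →
      ∃ θ : Z ≅ Z', h ≫ θ.hom = h' ∧ g = θ.hom ≫ g'
  eq_id_of_minus : ∀ {X Y : C} (f : X ⟶ Y) (θ : Y ≅ Y), M f → f ≫ θ.hom = f → θ.hom = 𝟙 Y

/-- A generalized Reedy structure is dualizable if moreover isomorphisms that fix a morphism of
`ℝ⁺` by precomposition are identities. -/
structure IsDualizableGeneralizedReedy {C : Type*} [Category C] (P M : MorphismProperty C)
    (d : C → ℕ) : Prop extends IsGeneralizedReedy P M d where
  eq_id_of_plus : ∀ {X Y : C} (f : X ⟶ Y) (θ : X ≅ X), P f → θ.hom ≫ f = f → θ.hom = 𝟙 X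

/-!
The whole argument rests on growing subgraphs: every subgraph of a tree arises from a single edge by
repeatedly attaching the star of a new vertex along one edge (`Subgraph.growth`), because a
connected subgraph can only leave another subgraph through an edge of the latter
(`Subgraph.exists_crossing`).

A subgraph is determined by its boundary (`Subgraph.boundary_injective`), so a morphism is
determined by its edge map (`Hom.ext_onEdge`). This gives the two rigidity statements about
isomorphisms fixing a morphism of `Ξ⁺` or `Ξ⁻`, and shows that Hom-sets are finite. Conversely,
an edge map together with pairwise vertex-disjoint subgraphs with the right boundaries, one for each
vertex, extends to a morphism (`Hom.ofVert`). In particular the orderings do not matter: an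
isomorphism of underlying graphs is an isomorphism in `Ξ` (`isoOfEquiv`), so there are only
countably many isomorphism classes.

The images of distinct vertices under a morphism `f` are vertex-disjoint, and images of subgraphs on
different sides of a vertex `w` meet the image of `w` only in images of edges at `w`
(`Hom.exists_separating_edge`). Hence `f` is injective on edges if and only if it collapses no
vertex to an edge (`plus_iff`), and if `f` is in `Ξ⁻` then every `f w` is an edge or the star of a
vertex (`onVert_eq_star`), since an interior edge of `f w` could not be in the image of `f`. Counting
vertices gives the degree inequalities, and in case of equality `f` is an isomorphism of graphs.

Finally, `f` factors through its image, whose edges are the edges in the range of `f` and whose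
vertices are the vertices of the source that are not collapsed (`Hom.imageGraph`). That the image is
a tree is again proved by growing: attaching a vertex attaches to the image a vertex with its edges
along exactly one edge, or nothing. Any other factorization of the required kind is identified with
this one by comparing graphs (`exists_iso_image`).
-/

/-! ### Subgraphs: order, crossings and growth -/

namespace Xi

variable {S : Xi.{u}}

theorem nbhd_nonempty (v : S.Vert) : (S.nbhd v).Nonempty :=
  ⟨_, (S.ordAt v 0).2⟩

/-- An edge cannot be incident to three different vertices. -/
theorem eq_or_eq_of_mem_nbhd {e : S.Edge} {v w x : S.Vert} (hv : e ∈ S.nbhd v) (hw : e ∈ S.nbhd w)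
    (hx : e ∈ S.nbhd x) (hvw : v ≠ w) : x = v ∨ x = w := by
  by_contra! h
  have h3 : ({v, w, x} : Set S.Vert).ncard ≤ 2 := by
    refine (Set.ncard_le_ncard ?_ (Set.toFinite _)).trans (S.ncard_le_two e)
    rintro y (rfl | rfl | rfl) <;> assumption
  rw [Set.ncard_insert_of_notMem (by simp [hvw, h.1.symm]), Set.ncard_pair h.2.symm] at h3
  omega

namespace Subgraph

/-- Subgraphs are ordered by inclusion. -/
instance : PartialOrder (Subgraph S) :=
  PartialOrder.lift (fun T => (T.verts, T.edges)) fun _ _ h =>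
    Subgraph.ext (congrArg Prod.fst h) (congrArg Prod.snd h)

theorem le_iff {T T' : Subgraph S} : T ≤ T' ↔ T.verts ⊆ T'.verts ∧ T.edges ⊆ T'.edges := Iff.rfl

instance : Finite (Subgraph S) :=
  Finite.of_injective (fun T : Subgraph S => (T.verts, T.edges)) fun _ _ h =>
    Subgraph.ext (congrArg Prod.fst h) (congrArg Prod.snd h)

/-- The subgraph without vertices given by an edge `e`. -/
def line (e : S.Edge) : Subgraph S where
  verts := ∅
  edges := {e}
  nbhd_subset v hv := hv.elim
  contractible := by
    refine isTree_of_preconnected ⟨.inr e, by simp [nodes]⟩ ?_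
    rintro ⟨x, hx⟩ ⟨y, hy⟩
    obtain rfl : x = .inr e := by simpa [nodes] using hx
    obtain rfl : y = .inr e := by simpa [nodes] using hy
    exact SimpleGraph.Reachable.refl _

/-- The whole tree as a subgraph of itself. -/
def whole (S : Xi.{u}) : Subgraph S where
  verts := Set.univ
  edges := Set.univ
  nbhd_subset v _ := Set.subset_univ _
  contractible := by
    have h : (nodes Set.univ Set.univ : Set (S.Vert ⊕ S.Edge)) = Set.univ := by
      ext (v | e) <;> simp [nodes]
    rw [h]
    exact (SimpleGraph.induceUnivIso S.incidence).isTree_iff.2 S.contractible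

@[simp] theorem verts_line (e : S.Edge) : (line e).verts = ∅ := rfl
@[simp] theorem edges_line (e : S.Edge) : (line e).edges = {e} := rfl
@[simp] theorem verts_star (v : S.Vert) : (star v).verts = {v} := rfl
@[simp] theorem edges_star (v : S.Vert) : (star v).edges = S.nbhd v := rfl
@[simp] theorem verts_union (T T' : Subgraph S) (h) :
    (T.union T' h).verts = T.verts ∪ T'.verts := rfl
@[simp] theorem edges_union (T T' : Subgraph S) (h) :
    (T.union T' h).edges = T.edges ∪ T'.edges := rfl
@[simp] theorem verts_inter (T T' : Subgraph S) (h) :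
    (T.inter T' h).verts = T.verts ∩ T'.verts := rfl
@[simp] theorem edges_inter (T T' : Subgraph S) (h) :
    (T.inter T' h).edges = T.edges ∩ T'.edges := rfl

theorem line_le {T : Subgraph S} {e : S.Edge} : line e ≤ T ↔ e ∈ T.edges := by simp [le_iff]

theorem star_le {T : Subgraph S} {v : S.Vert} : star v ≤ T ↔ v ∈ T.verts := by
  simp only [le_iff, verts_star, Set.singleton_subset_iff, edges_star, and_iff_left_iff_imp]
  exact T.nbhd_subset v

theorem union_le {T T' A : Subgraph S} {h} (hT : T ≤ A) (hT' : T' ≤ A) : T.union T' h ≤ A :=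
  ⟨Set.union_subset hT.1 hT'.1, Set.union_subset hT.2 hT'.2⟩

theorem le_union_left {T T' : Subgraph S} {h} : T ≤ T.union T' h :=
  ⟨Set.subset_union_left, Set.subset_union_left⟩

theorem inter_eq_left {T T' : Subgraph S} {h} (hle : T ≤ T') : T.inter T' h = T :=
  Subgraph.ext (Set.inter_eq_left.2 hle.1) (Set.inter_eq_left.2 hle.2)

theorem edges_nonempty (T : Subgraph S) : T.edges.Nonempty := by
  obtain ⟨⟨x, hx⟩⟩ := T.contractible.connected.nonempty
  rcases x with v | e
  · exact (nbhd_nonempty v).mono (T.nbhd_subset v (by simpa [nodes] using hx))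
  · exact ⟨e, by simpa [nodes] using hx⟩

/-- Overlapping subgraphs have an edge in common, as every vertex has an incident edge. -/
theorem overlap_iff {T T' : Subgraph S} : T.Overlap T' ↔ (T.edges ∩ T'.edges).Nonempty := by
  refine ⟨?_, Or.inr⟩
  rintro (⟨v, hv⟩ | h)
  · exact (nbhd_nonempty v).mono
      (Set.subset_inter (T.nbhd_subset v hv.1) (T'.nbhd_subset v hv.2))
  · exact h

theorem overlap_of_mem {T T' : Subgraph S} {e : S.Edge} (h : e ∈ T.edges) (h' : e ∈ T'.edges) :
    T.Overlap T' := Or.inr ⟨e, h, h'⟩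

theorem overlap_of_le {T T' : Subgraph S} (h : T ≤ T') : T.Overlap T' :=
  T.edges_nonempty.elim fun _ he => overlap_of_mem he (h.2 he)

/-- A connected subgraph `T` that meets `A` without being contained in it leaves `A` through an
edge of `A` followed by a vertex outside `A`: a vertex of `A` has all its edges in `A`. -/
theorem exists_crossing {T A : Subgraph S} (h : T.Overlap A) (hle : ¬ T ≤ A) :
    ∃ a ∈ T.edges, ∃ b ∈ T.verts, a ∈ A.edges ∧ b ∉ A.verts ∧ a ∈ S.nbhd b := by
  obtain ⟨x, hxT, hxA⟩ := h.nonempty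
  obtain ⟨y, hyT, hyA⟩ : ∃ y, y ∈ nodes T.verts T.edges ∧ y ∉ nodes A.verts A.edges := by
    by_contra! hc
    refine hle ⟨fun v hv => ?_, fun e he => ?_⟩
    · simpa [nodes] using hc (.inl v) (by simpa [nodes] using hv)
    · simpa [nodes] using hc (.inr e) (by simpa [nodes] using he)
  obtain ⟨p⟩ := T.contractible.connected.preconnected ⟨x, hxT⟩ ⟨y, hyT⟩
  obtain ⟨d, -, hd1, hd2⟩ := p.exists_boundary_dart {z | z.1 ∈ nodes A.verts A.edges} hxA hyA
  have hadj := d.adj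
  rw [Set.mem_ofPred_eq] at hd1 hd2
  rcases hf : d.fst with ⟨v | a, hv⟩ <;> rcases hs : d.snd with ⟨w | b, hw⟩ <;>
    rw [hf, hs] at hadj
  · exact hadj.elim
  · refine (hd2 ?_).elim
    have hvA : v ∈ A.verts := by simpa [hf, nodes] using hd1
    simpa [hs, nodes] using A.nbhd_subset v hvA hadj
  · refine ⟨a, by simpa [nodes] using hv, w, by simpa [nodes] using hw, ?_, ?_, hadj⟩
    · simpa [hf, nodes] using hd1
    · simpa [hs, nodes] using hd2
  · exact hadj.elim

theorem eq_line_of_verts_eq_empty {T : Subgraph S} (hT : T.verts = ∅) {e : S.Edge}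
    (he : e ∈ T.edges) : T = line e := by
  refine le_antisymm ?_ (line_le.2 he)
  by_contra hle
  obtain ⟨a, -, b, hb, -⟩ := exists_crossing (overlap_of_mem he rfl : T.Overlap (line e)) hle
  simp [hT] at hb

theorem exists_vert_of_mem_edges {T : Subgraph S} (hT : T.verts.Nonempty) {e : S.Edge}
    (he : e ∈ T.edges) : ∃ v ∈ T.verts, e ∈ S.nbhd v := by
  obtain ⟨a, -, b, hb, ha, -, hab⟩ := exists_crossing
    (overlap_of_mem he rfl : T.Overlap (line e)) fun hle => by
      obtain ⟨v, hv⟩ := hT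
      exact hle.1 hv
  obtain rfl : a = e := ha
  exact ⟨b, hb, hab⟩

/-- Nested subgraphs with the same vertices coincide. -/
theorem eq_of_le_of_verts {T T' : Subgraph S} (hle : T ≤ T') (hv : T'.verts ⊆ T.verts) :
    T = T' := by
  refine le_antisymm hle ⟨hv, fun e he => ?_⟩
  rcases T'.verts.eq_empty_or_nonempty with h | h
  · obtain ⟨a, ha⟩ := T.edges_nonempty
    have h1 := eq_line_of_verts_eq_empty h (hle.2 ha)
    rw [h1] at he
    obtain rfl : e = a := he
    exact ha
  · obtain ⟨v, hvT, hev⟩ := exists_vert_of_mem_edges h he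
    exact T.nbhd_subset v (hv hvT) hev

/-- Vertex-disjoint subgraphs have at most one edge in common. -/
theorem eq_of_mem_edges_of_disjoint {T T' : Subgraph S} (hd : Disjoint T.verts T'.verts)
    {a e : S.Edge} (ha : a ∈ T.edges) (ha' : a ∈ T'.edges) (he : e ∈ T.edges)
    (he' : e ∈ T'.edges) : e = a := by
  have h := eq_line_of_verts_eq_empty (T := T.inter T' (overlap_of_mem ha ha'))
    hd.inter_eq ⟨ha, ha'⟩
  have : e ∈ (T.inter T' (overlap_of_mem ha ha')).edges := ⟨he, he'⟩
  rwa [h] at this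

/-- Every subgraph is built from a single edge by repeatedly attaching the star of a new vertex `b`
along an edge `a`. -/
theorem growth {motive : Subgraph S → Prop} (line : ∀ e, motive (line e))
    (attach : ∀ (T : Subgraph S) (a : S.Edge) (b : S.Vert) (ha : a ∈ T.edges)
      (hab : a ∈ S.nbhd b), b ∉ T.verts → motive T →
      motive (T.union (star b) (overlap_of_mem ha hab)))
    (T : Subgraph S) : motive T := by
  obtain ⟨e, he⟩ := T.edges_nonempty
  obtain ⟨M, hM⟩ := (Set.toFinite {A : Subgraph S | A ≤ T ∧ motive A}).exists_maximal
    ⟨_, line_le.2 he, line e⟩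
  obtain ⟨⟨hMT, hm⟩, hmax⟩ := hM
  suffices h : T ≤ M by rwa [le_antisymm h hMT]
  by_contra hle
  obtain ⟨f, hf⟩ := M.edges_nonempty
  obtain ⟨a, -, b, hb, ha, hbM, hab⟩ := exists_crossing (overlap_of_mem (hMT.2 hf) hf) hle
  have := hmax ⟨union_le hMT (star_le.2 hb), attach M a b ha hab hbM hm⟩ le_union_left
  exact hbM (this.1 (Or.inr rfl))

/-- A subgraph avoiding a vertex `w` extends to a subgraph that still avoids `w` but reaches an edge
at `w`: take a maximal subgraph avoiding `w`. -/
theorem exists_branch {T : Subgraph S} {w : S.Vert} (hw : w ∉ T.verts) :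
    ∃ B, T ≤ B ∧ w ∉ B.verts ∧ ∃ a ∈ B.edges, a ∈ S.nbhd w := by
  obtain ⟨B, hB⟩ := (Set.toFinite {A : Subgraph S | T ≤ A ∧ w ∉ A.verts}).exists_maximal
    ⟨T, le_rfl, hw⟩
  obtain ⟨⟨hTB, hwB⟩, hmax⟩ := hB
  refine ⟨B, hTB, hwB, ?_⟩
  obtain ⟨f, hf⟩ := B.edges_nonempty
  obtain ⟨a, -, b, -, ha, hbB, hab⟩ := exists_crossing (T := whole S) (A := B)
    (overlap_of_mem (Set.mem_univ f) hf) fun h => hwB (h.1 (Set.mem_univ w))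
  obtain rfl | hne := eq_or_ne b w
  · exact ⟨a, ha, hab⟩
  have := hmax (y := B.union (star b) (overlap_of_mem ha hab))
    ⟨hTB.trans le_union_left, by simp [hwB, hne.symm]⟩ le_union_left
  exact (hbB (this.1 (Or.inr rfl))).elim

/-! ### Boundaries -/

theorem mem_boundary_of_nonempty {T : Subgraph S} (hT : T.verts.Nonempty) {e : S.Edge} :
    e ∈ T.boundary ↔ e ∈ T.legs := by
  simp [boundary, hT.ne_empty]

theorem nodup_boundary {T : Subgraph S} (hT : T.verts.Nonempty) : T.boundary.Nodup := by
  rw [boundary, if_neg hT.ne_empty]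
  exact Finset.nodup _

@[simp] theorem boundary_line (e : S.Edge) : (line e).boundary = {e} + {e} := by
  simp [boundary]

theorem mem_boundary_star {v : S.Vert} {e : S.Edge} :
    e ∈ (star v).boundary ↔ e ∈ S.nbhd v := by
  rw [mem_boundary_of_nonempty (Set.singleton_nonempty v)]
  refine ⟨fun h => h.1, fun h => ⟨h, ?_⟩⟩
  rintro ⟨x, rfl, y, rfl, hne, -⟩
  exact hne rfl

theorem nodup_boundary_star (v : S.Vert) : (star v).boundary.Nodup := nodup_boundary ⟨v, rfl⟩

/-- The boundary counts every edge twice, minus its incidences with vertices of the subgraph. -/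
theorem count_boundary [DecidableEq S.Edge] (T : Subgraph S) (e : S.Edge)
    [Decidable (e ∈ T.edges)] :
    T.boundary.count e + {v ∈ T.verts | e ∈ S.nbhd v}.ncard = if e ∈ T.edges then 2 else 0 := by
  rcases T.verts.eq_empty_or_nonempty with h | h
  · obtain ⟨a, ha⟩ := T.edges_nonempty
    obtain rfl := eq_line_of_verts_eq_empty h ha
    have h0 : {v ∈ (line a).verts | e ∈ S.nbhd v} = ∅ := by simp
    rw [h0, boundary_line]
    by_cases hea : e = a
    · subst hea; simp
    · simp [hea]
  · split_ifs with he
    · obtain ⟨v, hv, hev⟩ := exists_vert_of_mem_edges h he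
      by_cases hl : e ∈ T.legs
      · rw [Multiset.count_eq_one_of_mem (nodup_boundary h) ((mem_boundary_of_nonempty h).2 hl)]
        have h1 : {v ∈ T.verts | e ∈ S.nbhd v} = {v} := by
          refine Set.eq_singleton_iff_unique_mem.2 ⟨⟨hv, hev⟩, fun w hw => ?_⟩
          by_contra hne
          exact hl.2 ⟨w, hw.1, v, hv, hne, hw.2, hev⟩
        rw [h1, Set.ncard_singleton]
      · rw [Multiset.count_eq_zero_of_notMem fun h' => hl ((mem_boundary_of_nonempty h).1 h')]
        obtain ⟨x, hx, y, hy, hne, hex, hey⟩ :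
            ∃ v ∈ T.verts, ∃ w ∈ T.verts, v ≠ w ∧ e ∈ S.nbhd v ∧ e ∈ S.nbhd w := by
          by_contra hc
          exact hl ⟨he, hc⟩
        have h1 : {v ∈ T.verts | e ∈ S.nbhd v} = {x, y} := by
          ext z
          refine ⟨fun hz => eq_or_eq_of_mem_nbhd hex hey hz.2 hne, ?_⟩
          rintro (rfl | rfl)
          exacts [⟨hx, hex⟩, ⟨hy, hey⟩]
        rw [h1, Set.ncard_pair hne]
    · rw [Multiset.count_eq_zero_of_notMem fun h' => he ((mem_boundary_of_nonempty h).1 h').1]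
      have h1 : {v ∈ T.verts | e ∈ S.nbhd v} = ∅ :=
        Set.eq_empty_of_forall_notMem fun v hv => he (T.nbhd_subset v hv.1 hv.2)
      rw [h1, Set.ncard_empty]

theorem mem_edges_of_mem_boundary {T : Subgraph S} {e : S.Edge} (h : e ∈ T.boundary) :
    e ∈ T.edges := by
  classical
  by_contra he
  have h1 := count_boundary T e
  rw [if_neg he] at h1
  have := Multiset.count_pos.2 h
  omega

/-- Gluing two vertex-disjoint subgraphs along a common edge `a` cancels the two copies of `a` in
their boundaries. -/
theorem boundary_union {T T' : Subgraph S} (hd : Disjoint T.verts T'.verts) {a : S.Edge}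
    (ha : a ∈ T.edges) (ha' : a ∈ T'.edges) :
    (T.union T' (overlap_of_mem ha ha')).boundary + ({a} + {a}) = T.boundary + T'.boundary := by
  classical
  ext e
  have h1 := count_boundary T e
  have h2 := count_boundary T' e
  have h3 := count_boundary (T.union T' (overlap_of_mem ha ha')) e
  have h4 : {v ∈ (T.union T' (overlap_of_mem ha ha')).verts | e ∈ S.nbhd v} =
      {v ∈ T.verts | e ∈ S.nbhd v} ∪ {v ∈ T'.verts | e ∈ S.nbhd v} := by
    ext v; simp [or_and_right]
  rw [h4, Set.ncard_union_eq (hd.mono (fun _ h => h.1) (fun _ h => h.1))] at h3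
  have h5 : (e ∈ T.edges ∧ e ∈ T'.edges) ↔ e = a :=
    ⟨fun h => eq_of_mem_edges_of_disjoint hd ha ha' h.1 h.2, by rintro rfl; exact ⟨ha, ha'⟩⟩
  simp only [edges_union, Set.mem_union] at h3
  simp only [Multiset.count_add, Multiset.count_singleton]
  split_ifs at * <;> first | omega | tauto

/-- Every subgraph has a leg: a subgraph without legs would be closed under adjacency, hence the
whole tree, which has a leg. -/
theorem legs_nonempty (T : Subgraph S) : T.legs.Nonempty := by
  by_contra hT
  have hle : whole S ≤ T := by
    by_contra hle
    obtain ⟨f, hf⟩ := T.edges_nonempty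
    obtain ⟨a, -, b, -, ha, hb, hab⟩ := exists_crossing (T := whole S) (A := T)
      (overlap_of_mem (Set.mem_univ f) hf) hle
    refine hT ⟨a, ha, ?_⟩
    rintro ⟨v, hv, w, hw, hne, hav, haw⟩
    rcases eq_or_eq_of_mem_nbhd hav haw hab hne with rfl | rfl
    exacts [hb hv, hb hw]
  obtain ⟨l, hl⟩ := S.exists_leg
  refine hT ⟨l, hle.2 (Set.mem_univ l), ?_⟩
  rintro ⟨v, -, w, -, h⟩
  exact hl ⟨v, w, h⟩

theorem mem_boundary_of_mem_legs {T : Subgraph S} {e : S.Edge} (h : e ∈ T.legs) :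
    e ∈ T.boundary := by
  rcases T.verts.eq_empty_or_nonempty with hT | hT
  · obtain rfl := eq_line_of_verts_eq_empty hT h.1
    simp
  · exact (mem_boundary_of_nonempty hT).2 h

/-- If two subgraphs with the same boundary share a vertex, the first is contained in the second:
otherwise it leaves the second through one of its legs `a`, which is interior to the first. -/
theorem le_of_boundary_eq_of_mem {T T' : Subgraph S} (h : T.boundary = T'.boundary) {v : S.Vert}
    (hv : v ∈ T.verts) (hv' : v ∈ T'.verts) : T ≤ T' := by
  by_contra hle
  have ho : T.Overlap T' := Or.inl ⟨v, hv, hv'⟩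
  obtain ⟨a, ha, b, hb, ha', hb', hab⟩ := exists_crossing ho hle
  obtain ⟨u, hu, hau⟩ := exists_vert_of_mem_edges (T := T.inter T' ho) ⟨v, hv, hv'⟩ ⟨ha, ha'⟩
  have hne : u ≠ b := fun h => hb' (h ▸ hu.2)
  have hleg : a ∈ T'.legs := by
    refine ⟨ha', ?_⟩
    rintro ⟨x, hx, y, hy, hxy, hax, hay⟩
    rcases eq_or_eq_of_mem_nbhd hax hay hab hxy with rfl | rfl
    exacts [hb' hx, hb' hy]
  have h1 := mem_boundary_of_mem_legs hleg
  rw [← h, mem_boundary_of_nonempty ⟨v, hv⟩] at h1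
  exact h1.2 ⟨u, hu.1, b, hb, hne, hau, hab⟩

/-- The boundary of a single edge lists that edge twice, all other boundaries have no repetition. -/
theorem verts_nonempty_iff_nodup {T : Subgraph S} : T.verts.Nonempty ↔ T.boundary.Nodup := by
  refine ⟨nodup_boundary, fun h => ?_⟩
  by_contra hT
  obtain ⟨e, he⟩ := T.edges_nonempty
  obtain rfl := eq_line_of_verts_eq_empty (Set.not_nonempty_iff_eq_empty.1 hT) he
  rw [boundary_line, Multiset.nodup_add] at h
  simp at h

/-- A subgraph is determined by its boundary. If two subgraphs with the same boundary had no common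
vertex, all their legs would become interior in their union, which would have no leg at all. -/
theorem boundary_injective : Function.Injective (boundary : Subgraph S → Multiset S.Edge) := by
  intro T T' h
  rcases T.verts.eq_empty_or_nonempty with hT | hT
  · have hT' : T'.verts = ∅ := by
      rw [← Set.not_nonempty_iff_eq_empty] at hT ⊢
      rwa [verts_nonempty_iff_nodup, ← h, ← verts_nonempty_iff_nodup]
    obtain ⟨e, he⟩ := T.edges_nonempty
    obtain ⟨e', he'⟩ := T'.edges_nonempty
    obtain rfl := eq_line_of_verts_eq_empty hT he
    obtain rfl := eq_line_of_verts_eq_empty hT' he'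
    have h1 : e ∈ (line e').boundary := h ▸ (by simp : e ∈ (line e).boundary)
    rw [show e = e' by simpa using h1]
  · have hT' : T'.verts.Nonempty := by
      rwa [verts_nonempty_iff_nodup, ← h, ← verts_nonempty_iff_nodup]
    have hlegs : T.legs = T'.legs := by
      ext e
      rw [← mem_boundary_of_nonempty hT, h, mem_boundary_of_nonempty hT']
    by_cases hv : (T.verts ∩ T'.verts).Nonempty
    · obtain ⟨v, hv, hv'⟩ := hv
      exact le_antisymm (le_of_boundary_eq_of_mem h hv hv')
        (le_of_boundary_eq_of_mem h.symm hv' hv)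
    exfalso
    obtain ⟨l, hl⟩ := T.legs_nonempty
    obtain ⟨p, hp, hnp⟩ := (T.union T' (overlap_of_mem hl.1 (hlegs ▸ hl).1)).legs_nonempty
    have hpT : p ∈ T.legs := by
      rcases hp with hp | hp
      · refine ⟨hp, ?_⟩
        rintro ⟨x, hx, y, hy, hxy⟩
        exact hnp ⟨x, Or.inl hx, y, Or.inl hy, hxy⟩
      · rw [hlegs]
        refine ⟨hp, ?_⟩
        rintro ⟨x, hx, y, hy, hxy⟩
        exact hnp ⟨x, Or.inr hx, y, Or.inr hy, hxy⟩
    obtain ⟨x, hx, hpx⟩ := exists_vert_of_mem_edges hT hpT.1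
    obtain ⟨y, hy, hpy⟩ := exists_vert_of_mem_edges hT' (hlegs ▸ hpT).1
    refine hnp ⟨x, Or.inl hx, y, Or.inr hy, ?_, hpx, hpy⟩
    rintro rfl
    exact hv ⟨x, hx, hy⟩

end Subgraph

end Xi

/-! ### Morphisms and their values on edges and vertices -/

namespace Xi

open Subgraph

variable {R S : Xi.{u}}

namespace Hom

/-- Morphisms are determined by their edge maps, because subgraphs are determined by their
boundaries. -/
theorem ext_onEdge {f g : Hom R S} (h : f.onEdge = g.onEdge) : f = g :=
  Hom.ext h (funext fun T => boundary_injective (by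
    rw [f.boundary_onSub, g.boundary_onSub, h]))

theorem onSub_line (f : Hom R S) (e : R.Edge) : f.onSub (line e) = line (f.onEdge e) :=
  boundary_injective (by simp [f.boundary_onSub])

theorem mono_onSub (f : Hom R S) {T T' : Subgraph R} (h : T ≤ T') : f.onSub T ≤ f.onSub T' := by
  have ho := overlap_of_le h
  have h1 := f.inter T T' ho
  rw [inter_eq_left h] at h1
  rw [h1]
  exact ⟨Set.inter_subset_right, Set.inter_subset_right⟩

theorem onEdge_mem (f : Hom R S) {T : Subgraph R} {e : R.Edge} (h : e ∈ T.edges) :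
    f.onEdge e ∈ (f.onSub T).edges := by
  rw [← line_le, ← onSub_line]
  exact f.mono_onSub (line_le.2 h)

theorem onVert_le (f : Hom R S) {T : Subgraph R} {v : R.Vert} (h : v ∈ T.verts) :
    f.onVert v ≤ f.onSub T :=
  f.mono_onSub (star_le.2 h)

theorem mem_verts_onSub (f : Hom R S) {T : Subgraph R} {x : S.Vert} :
    x ∈ (f.onSub T).verts ↔ ∃ v ∈ T.verts, x ∈ (f.onVert v).verts := by
  induction T using growth with
  | line e => simp [onSub_line]
  | attach T a b ha hab hb ih => simp [f.union, ih, onVert, or_comm]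

theorem boundary_onVert (f : Hom R S) (v : R.Vert) :
    (f.onVert v).boundary = (star v).boundary.map f.onEdge := f.boundary_onSub _

theorem mem_boundary_onVert (f : Hom R S) {v : R.Vert} {p : S.Edge} :
    p ∈ (f.onVert v).boundary ↔ p ∈ f.onEdge '' R.nbhd v := by
  simp [boundary_onVert, mem_boundary_star]

/-- If `w` is a vertex outside `T`, the images of `T` and `w` have no common vertex, and every
common edge is the image of one and the same edge at `w`: the edge joining `w` to a branch of the
tree that contains `T`. -/
theorem exists_separating_edge (f : Hom R S) {T : Subgraph R} {w : R.Vert} (hw : w ∉ T.verts) :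
    ∃ a ∈ R.nbhd w, Disjoint (f.onSub T).verts (f.onVert w).verts ∧
      ∀ p ∈ (f.onSub T).edges, p ∈ (f.onVert w).edges → p = f.onEdge a := by
  obtain ⟨B, hTB, hwB, a, haB, haw⟩ := exists_branch hw
  have ho : B.Overlap (star w) := overlap_of_mem haB haw
  have h1 : B.inter (star w) ho = line a :=
    eq_line_of_verts_eq_empty (by simp [hwB]) ⟨haB, haw⟩
  have h2 := f.inter B (star w) ho
  rw [h1, onSub_line] at h2
  have hB := f.mono_onSub hTB
  refine ⟨a, haw, Set.disjoint_left.2 fun x hx hx' => ?_, fun p hp hp' => ?_⟩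
  · have : x ∈ (line (f.onEdge a)).verts := h2 ▸ ⟨hB.1 hx, hx'⟩
    exact this
  · have : p ∈ (line (f.onEdge a)).edges := h2 ▸ ⟨hB.2 hp, hp'⟩
    exact this

theorem disjoint_onVert (f : Hom R S) {v w : R.Vert} (h : v ≠ w) :
    Disjoint (f.onVert v).verts (f.onVert w).verts :=
  (f.exists_separating_edge (T := star v) (w := w) (by simpa using h.symm)).choose_spec.2.1

theorem eq_of_mem_onVert (f : Hom R S) {v w : R.Vert} {x : S.Vert}
    (hv : x ∈ (f.onVert v).verts) (hw : x ∈ (f.onVert w).verts) : v = w := by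
  by_contra h
  exact Set.disjoint_left.1 (f.disjoint_onVert h) hv hw

/-! ### Construction of morphisms -/

/-- Subgraphs assigned to the vertices of `R`, with boundaries prescribed by an edge map and
pairwise vertex-disjoint, glue to a subgraph for every subgraph of `R`. -/
theorem exists_glued (f₀ : R.Edge → S.Edge) (F : R.Vert → Subgraph S)
    (hF : ∀ v, (F v).boundary = (star v).boundary.map f₀)
    (hd : ∀ v w, v ≠ w → Disjoint (F v).verts (F w).verts) (T : Subgraph R) :
    ∃ A : Subgraph S, A.verts = (⋃ v ∈ T.verts, (F v).verts) ∧
      A.edges = (⋃ v ∈ T.verts, (F v).edges) ∪ f₀ '' T.edges ∧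
      A.boundary = T.boundary.map f₀ := by
  induction T using growth with
  | line e => exact ⟨line (f₀ e), by simp, by simp, by simp⟩
  | attach T a b ha hab hb ih =>
    obtain ⟨A, hAv, hAe, hAb⟩ := ih
    have hmem : ∀ e ∈ R.nbhd b, f₀ e ∈ (F b).edges := fun e he =>
      mem_edges_of_mem_boundary
        (hF b ▸ Multiset.mem_map_of_mem f₀ (mem_boundary_star.2 he))
    have haA : f₀ a ∈ A.edges := hAe ▸ Or.inr ⟨a, ha, rfl⟩
    have hdis : Disjoint A.verts (F b).verts := by
      rw [hAv]
      simp only [Set.disjoint_iUnion_left]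
      rintro v hv
      exact hd v b (by rintro rfl; exact hb hv)
    refine ⟨A.union (F b) (overlap_of_mem haA (hmem a hab)), ?_, ?_, ?_⟩
    · simp [hAv, Set.union_comm]
    · have h1 : f₀ '' R.nbhd b ⊆ (F b).edges := by
        rintro _ ⟨e, he, rfl⟩
        exact hmem e he
      simp only [edges_union, hAe, verts_union, verts_star, edges_star, Set.image_union,
        Set.biUnion_union, Set.biUnion_singleton]
      ext p
      have := @h1 p
      simp only [Set.mem_union]
      tauto
    · have h1 := boundary_union hdis haA (hmem a hab)
      have h2 := boundary_union (T := T) (T' := star b)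
        (Set.disjoint_singleton_right.2 hb) ha hab
      rw [hAb, hF b, ← Multiset.map_add, ← h2] at h1
      simpa using h1

/-- The morphism with a given edge map and given values on vertices, provided that these have the
right boundaries and are pairwise vertex-disjoint. -/
noncomputable def ofVert (f₀ : R.Edge → S.Edge) (F : R.Vert → Subgraph S)
    (hF : ∀ v, (F v).boundary = (star v).boundary.map f₀)
    (hd : ∀ v w, v ≠ w → Disjoint (F v).verts (F w).verts) : Hom R S :=
  have hov : ∀ {T T' : Subgraph R}, T.Overlap T' →
      (exists_glued f₀ F hF hd T).choose.Overlap (exists_glued f₀ F hF hd T').choose := by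
    intro T T' h
    obtain ⟨e, he, he'⟩ := overlap_iff.1 h
    refine overlap_of_mem (e := f₀ e) ?_ ?_
    · rw [(exists_glued f₀ F hF hd T).choose_spec.2.1]
      exact Or.inr ⟨e, he, rfl⟩
    · rw [(exists_glued f₀ F hF hd T').choose_spec.2.1]
      exact Or.inr ⟨e, he', rfl⟩
  { onEdge := f₀
    onSub := fun T => (exists_glued f₀ F hF hd T).choose
    boundary_onSub := fun T => (exists_glued f₀ F hF hd T).choose_spec.2.2
    overlap := hov
    inter := by
      intro T T' h
      obtain ⟨hv, he, -⟩ := (exists_glued f₀ F hF hd T).choose_spec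
      obtain ⟨hv', he', -⟩ := (exists_glued f₀ F hF hd T').choose_spec
      obtain ⟨hv'', he'', -⟩ := (exists_glued f₀ F hF hd (T.inter T' h)).choose_spec
      -- Nested subgraphs with the same vertices coincide, so the reverse inclusion has to be
      -- checked on vertices only, where it follows from disjointness.
      refine eq_of_le_of_verts (le_iff.2 ⟨?_, ?_⟩) ?_
      · rw [hv'', verts_inter, verts_inter, hv, hv']
        exact Set.subset_inter (Set.biUnion_subset_biUnion_left Set.inter_subset_left)
          (Set.biUnion_subset_biUnion_left Set.inter_subset_right)
      · rw [he'', edges_inter, edges_inter, verts_inter, he, he']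
        exact Set.subset_inter
          (Set.union_subset_union (Set.biUnion_subset_biUnion_left Set.inter_subset_left)
            (Set.image_mono Set.inter_subset_left))
          (Set.union_subset_union (Set.biUnion_subset_biUnion_left Set.inter_subset_right)
            (Set.image_mono Set.inter_subset_right))
      · rw [hv'', verts_inter, verts_inter, hv, hv']
        rintro x ⟨hx, hx'⟩
        simp only [Set.mem_iUnion, exists_prop] at hx hx' ⊢
        obtain ⟨v, hvT, hxv⟩ := hx
        obtain ⟨w, hwT, hxw⟩ := hx'
        obtain rfl : v = w := by
          by_contra hne
          exact Set.disjoint_left.1 (hd v w hne) hxv hxw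
        exact ⟨v, ⟨hvT, hwT⟩, hxv⟩
    union := by
      intro T T' h
      obtain ⟨hv, he, -⟩ := (exists_glued f₀ F hF hd T).choose_spec
      obtain ⟨hv', he', -⟩ := (exists_glued f₀ F hF hd T').choose_spec
      obtain ⟨hv'', he'', -⟩ := (exists_glued f₀ F hF hd (T.union T' h)).choose_spec
      refine Subgraph.ext ?_ ?_
      · rw [hv'', verts_union, verts_union, hv, hv', Set.biUnion_union]
      · rw [he'', edges_union, edges_union, verts_union, he, he', Set.biUnion_union,
          Set.image_union, Set.union_union_union_comm] }

@[simp] theorem onEdge_ofVert (f₀ : R.Edge → S.Edge) (F : R.Vert → Subgraph S) (hF) (hd) :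
    (ofVert f₀ F hF hd).onEdge = f₀ := rfl

@[simp] theorem onVert_ofVert (f₀ : R.Edge → S.Edge) (F : R.Vert → Subgraph S) (hF) (hd)
    (v : R.Vert) : (ofVert f₀ F hF hd).onVert v = F v :=
  boundary_injective (by rw [boundary_onVert, hF, onEdge_ofVert])

/-- The morphism induced by an isomorphism of the underlying graphs. -/
noncomputable def ofEquiv (ε : R.Edge ≃ S.Edge) (ν : R.Vert ≃ S.Vert)
    (h : ∀ v e, e ∈ R.nbhd v ↔ ε e ∈ S.nbhd (ν v)) : Hom R S :=
  ofVert ε (fun v => star (ν v))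
    (fun v => by
      refine (Multiset.Nodup.ext (nodup_boundary_star _)
        ((nodup_boundary_star v).map ε.injective)).2 fun p => ?_
      obtain ⟨e, rfl⟩ := ε.surjective p
      simp [mem_boundary_star, h])
    (fun v w hne => by simpa using hne)

end Hom

@[simp] theorem onEdge_id (R : Xi.{u}) : Hom.onEdge (𝟙 R) = id := rfl

@[simp] theorem onEdge_comp {T : Xi.{u}} (f : R ⟶ S) (g : S ⟶ T) :
    Hom.onEdge (f ≫ g) = Hom.onEdge g ∘ Hom.onEdge f := rfl

theorem onVert_comp {T : Xi.{u}} (f : R ⟶ S) (g : S ⟶ T) (v : R.Vert) :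
    Hom.onVert (f ≫ g) v = Hom.onSub g (Hom.onVert f v) := rfl

theorem hom_ext {f g : R ⟶ S} (h : Hom.onEdge f = Hom.onEdge g) : f = g := Hom.ext_onEdge h

/-- An isomorphism of the underlying graphs is an isomorphism of trees: the orderings play no role
for morphisms. -/
noncomputable def isoOfEquiv (ε : R.Edge ≃ S.Edge) (ν : R.Vert ≃ S.Vert)
    (h : ∀ v e, e ∈ R.nbhd v ↔ ε e ∈ S.nbhd (ν v)) : R ≅ S where
  hom := Hom.ofEquiv ε ν h
  inv := Hom.ofEquiv ε.symm ν.symm (fun v e => by simp [h])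
  hom_inv_id := hom_ext (funext ε.symm_apply_apply)
  inv_hom_id := hom_ext (funext ε.apply_symm_apply)

/-! ### The classes `Ξ⁺` and `Ξ⁻` -/

/-- A morphism is injective on edges when no vertex is collapsed to an edge. -/
theorem Hom.injective_onEdge (f : Hom R S) (hf : ∀ v, (f.onVert v).verts.Nonempty) :
    Function.Injective f.onEdge := by
  suffices h : ∀ T : Subgraph R, Set.InjOn f.onEdge T.edges from
    fun e e' => h (whole R) (Set.mem_univ e) (Set.mem_univ e')
  intro T
  induction T using growth with
  | line e => simp
  | attach T a b ha hab hb ih =>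
    have hinj : Set.InjOn f.onEdge (R.nbhd b) := by
      have h1 := nodup_boundary (hf b)
      rw [boundary_onVert] at h1
      exact fun x hx y hy =>
        Multiset.inj_on_of_nodup_map h1 x (mem_boundary_star.2 hx) y (mem_boundary_star.2 hy)
    have key : ∀ e ∈ T.edges, ∀ e' ∈ R.nbhd b, f.onEdge e = f.onEdge e' → e = e' := by
      intro e he e' he' hee
      have ho : T.Overlap (star b) := overlap_of_mem ha hab
      have h1 := f.inter T (star b) ho
      rw [eq_line_of_verts_eq_empty (T := T.inter (star b) ho) (by simp [hb]) ⟨ha, hab⟩,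
        onSub_line] at h1
      have h2 : f.onEdge e' ∈ (line (f.onEdge a)).edges :=
        h1 ▸ ⟨hee ▸ f.onEdge_mem he, f.onEdge_mem (T := star b) he'⟩
      rw [ih he ha (hee.trans h2), hinj he' hab h2]
    rintro e (he | he) e' (he' | he') hee
    · exact ih he he' hee
    · exact key e he e' he' hee
    · exact (key e' he' e he hee.symm).symm
    · exact hinj he he' hee

theorem plus_iff (f : R ⟶ S) : plus f ↔ ∀ v, (Hom.onVert f v).verts.Nonempty := by
  refine ⟨fun hf v => ?_, Hom.injective_onEdge f⟩
  rw [verts_nonempty_iff_nodup, Hom.boundary_onVert]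
  exact (nodup_boundary_star v).map hf

/-- A morphism in `Ξ⁻` sends every vertex to an edge or to the star of a vertex: an interior edge
of the image of `w` would have to be the image of an edge at `w`, that is, a leg. -/
theorem onVert_eq_star (f : R ⟶ S) (hf : minus f) {w : R.Vert} {x : S.Vert}
    (hx : x ∈ (Hom.onVert f w).verts) : Hom.onVert f w = star x := by
  refine (eq_of_le_of_verts (star_le.2 hx) ?_).symm
  by_contra hle
  obtain ⟨c₀, hc0⟩ := nbhd_nonempty x
  obtain ⟨a, ha, b, hb, hax, hbx, hab⟩ := exists_crossing (T := Hom.onVert f w) (A := star x)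
    (overlap_of_mem ((Hom.onVert f w).nbhd_subset x hx hc0) hc0) fun h => hle h.1
  obtain ⟨e, rfl⟩ := hf.1 a
  obtain ⟨c, hc, -, hcon⟩ := Hom.exists_separating_edge f (T := line e) (w := w) (by simp)
  have h1 := hcon (Hom.onEdge f e) (Hom.onEdge_mem f rfl) ha
  have h2 : Hom.onEdge f e ∈ (Hom.onVert f w).boundary :=
    (Hom.mem_boundary_onVert f).2 ⟨c, hc, h1.symm⟩
  rw [mem_boundary_of_nonempty ⟨x, hx⟩] at h2
  exact h2.2 ⟨x, hx, b, hb, fun h => hbx h.symm, hax, hab⟩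

theorem degree_le_of_plus (f : R ⟶ S) (hf : plus f) : R.degree ≤ S.degree := by
  rw [plus_iff] at hf
  choose φ hφ using hf
  exact Nat.card_le_card_of_injective φ fun v w h =>
    Hom.eq_of_mem_onVert f (hφ v) (h ▸ hφ w)

theorem degree_le_of_minus (f : R ⟶ S) (hf : minus f) : S.degree ≤ R.degree := by
  choose φ hφ using hf.2
  refine Nat.card_le_card_of_injective φ fun v w h => ?_
  have h1 := onVert_eq_star f hf (hφ v)
  have h2 := onVert_eq_star f hf (hφ w)
  rw [h, h2] at h1
  exact (Set.singleton_injective (congrArg Subgraph.verts h1)).symm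

theorem isIso_of_plus_of_minus (f : R ⟶ S) (hp : plus f) (hm : minus f) : IsIso f := by
  choose φ hφ using (plus_iff f).1 hp
  have hstar : ∀ v, Hom.onVert f v = star (φ v) := fun v => onVert_eq_star f hm (hφ v)
  have hbij : Function.Bijective φ := by
    refine ⟨fun v w h => Hom.eq_of_mem_onVert f (hφ v) (h ▸ hφ w), fun x => ?_⟩
    obtain ⟨w, hw⟩ := hm.2 x
    rw [hstar] at hw
    exact ⟨w, hw.symm⟩
  have h : f = (isoOfEquiv (Equiv.ofBijective _ ⟨hp, hm.1⟩) (Equiv.ofBijective φ hbij)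
      fun v e => by
        change e ∈ R.nbhd v ↔ Hom.onEdge f e ∈ S.nbhd (φ v)
        rw [← mem_boundary_star, ← mem_boundary_star, ← hstar, Hom.boundary_onVert,
          Multiset.mem_map_of_injective hp]).hom := hom_ext rfl
  rw [h]
  infer_instance

theorem plus_of_isIso (f : R ⟶ S) [IsIso f] : plus f := by
  have h : Hom.onEdge (inv f) ∘ Hom.onEdge f = id := by
    rw [← onEdge_comp, IsIso.hom_inv_id, onEdge_id]
  exact Function.LeftInverse.injective (congrFun h)

theorem minus_of_isIso (f : R ⟶ S) [IsIso f] : minus f := by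
  refine ⟨?_, fun v => ?_⟩
  · have h : Hom.onEdge f ∘ Hom.onEdge (inv f) = id := by
      rw [← onEdge_comp, IsIso.inv_hom_id, onEdge_id]
    exact Function.RightInverse.surjective (congrFun h)
  · have h : Hom.onSub f (Hom.onSub (inv f) (star v)) = star v :=
      congrArg (fun g : S ⟶ S => Hom.onSub g (star v)) (IsIso.inv_hom_id f)
    have h1 : v ∈ (Hom.onSub f (Hom.onSub (inv f) (star v))).verts := by rw [h]; rfl
    obtain ⟨w, -, hw⟩ := (Hom.mem_verts_onSub f).1 h1
    exact ⟨w, hw⟩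

/-- A morphism in `Ξ⁺` between trees of the same degree is in `Ξ⁻`. -/
theorem minus_of_plus_of_degree_eq (f : R ⟶ S) (hf : plus f) (hd : R.degree = S.degree) :
    minus f := by
  choose φ hφ using (plus_iff f).1 hf
  have hinj : Function.Injective φ := fun v w h => Hom.eq_of_mem_onVert f (hφ v) (h ▸ hφ w)
  have hsurj : Function.Surjective φ := ((Nat.bijective_iff_injective_and_card φ).2 ⟨hinj, hd⟩).2
  have hverts : ∀ v, (Hom.onVert f v).verts = {φ v} := by
    intro v
    refine Set.eq_singleton_iff_unique_mem.2 ⟨hφ v, fun x hx => ?_⟩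
    obtain ⟨w, rfl⟩ := hsurj x
    rw [Hom.eq_of_mem_onVert f hx (hφ w)]
  have hstar : ∀ v, Hom.onVert f v = star (φ v) := fun v =>
    (eq_of_le_of_verts (star_le.2 (hφ v)) (hverts v).le).symm
  refine ⟨fun p => ?_, fun x => ?_⟩
  · rcases isEmpty_or_nonempty S.Vert with hS | ⟨⟨x⟩⟩
    · obtain ⟨e, -⟩ := (whole R).edges_nonempty
      have h1 := eq_line_of_verts_eq_empty (T := whole S)
        (Set.eq_empty_of_isEmpty _) (Set.mem_univ (Hom.onEdge f e))
      have h2 : p ∈ (line (Hom.onEdge f e)).edges := h1 ▸ Set.mem_univ p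
      exact ⟨e, h2.symm⟩
    · obtain ⟨y, -, hy⟩ := exists_vert_of_mem_edges (T := whole S) ⟨x, Set.mem_univ x⟩
        (Set.mem_univ p)
      obtain ⟨v, rfl⟩ := hsurj y
      rw [← mem_boundary_star, ← hstar, Hom.mem_boundary_onVert] at hy
      obtain ⟨e, -, he⟩ := hy
      exact ⟨e, he⟩
  · obtain ⟨v, rfl⟩ := hsurj x
    exact ⟨v, hφ v⟩

/-- A morphism in `Ξ⁻` between trees of the same degree is in `Ξ⁺`. -/
theorem plus_of_minus_of_degree_eq (f : R ⟶ S) (hf : minus f) (hd : R.degree = S.degree) :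
    plus f := by
  choose φ hφ using hf.2
  have hinj : Function.Injective φ := fun v w h => by
    have h1 := onVert_eq_star f hf (hφ v)
    rw [h, onVert_eq_star f hf (hφ w)] at h1
    exact (Set.singleton_injective (congrArg Subgraph.verts h1)).symm
  have hsurj : Function.Surjective φ :=
    ((Nat.bijective_iff_injective_and_card φ).2 ⟨hinj, hd.symm⟩).2
  refine (plus_iff f).2 fun v => ?_
  obtain ⟨x, rfl⟩ := hsurj v
  exact ⟨x, hφ x⟩

instance plus_isMultiplicative : plus.{u}.IsMultiplicative where
  id_mem _ := Function.injective_id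
  comp_mem f g hf hg :=
    show Function.Injective (Hom.onEdge g ∘ Hom.onEdge f) from Function.Injective.comp hg hf

instance minus_isMultiplicative : minus.{u}.IsMultiplicative where
  id_mem _ := ⟨Function.surjective_id, fun v => ⟨v, rfl⟩⟩
  comp_mem f g hf hg := by
    refine ⟨hg.1.comp hf.1, fun x => ?_⟩
    obtain ⟨v, hv⟩ := hg.2 x
    obtain ⟨w, hw⟩ := hf.2 v
    exact ⟨w, (Hom.onVert_le g hw).1 hv⟩

end Xi

/-! ### The image of a morphism -/

/-- A graph is acyclic if every nonempty set of nodes contains a node with at most one neighbour in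
that set: the nodes of a cycle form a set in which every node has two neighbours. -/
theorem SimpleGraph.isAcyclic_of_exists_subsingleton_neighbors {V : Type*} {G : SimpleGraph V}
    (h : ∀ A : Set V, A.Nonempty →
      ∃ x ∈ A, ∀ y ∈ A, ∀ z ∈ A, G.Adj x y → G.Adj x z → y = z) : G.IsAcyclic := by
  classical
  intro v c hc
  obtain ⟨x, hx : x ∈ c.support, hxu⟩ := h {z | z ∈ c.support} ⟨v, c.start_mem_support⟩
  have hr := hc.rotate hx
  have hsupp : ∀ z ∈ (c.rotate x hx).support, z ∈ c.support := fun z hz =>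
    (c.mem_support_rotate_iff x hx).1 hz
  exact hr.snd_ne_penultimate (hxu _ (hsupp _ (SimpleGraph.Walk.getVert_mem_support _ _)) _
    (hsupp _ (SimpleGraph.Walk.getVert_mem_support _ _))
    (SimpleGraph.Walk.adj_snd hr.not_nil) (SimpleGraph.Walk.adj_penultimate hr.not_nil).symm)

namespace Xi

open Subgraph

variable {R S : Xi.{u}}

/-- An ordering of the legs as required for an object of `Ξ` exists for every graph with a leg. -/
theorem exists_ord (G : LegGraph.{u}) (hl : G.legs.Nonempty) :
    ∃ (n : ℕ) (o : Fin (n + 1) → G.legs),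
      (Nonempty G.Vert → Function.Bijective o) ∧ (IsEmpty G.Vert → n = 1) := by
  have : Nonempty G.legs := hl.to_subtype
  rcases isEmpty_or_nonempty G.Vert with h | h
  · exact ⟨1, fun _ => ⟨_, hl.some_mem⟩, fun ⟨v⟩ => h.elim v, fun _ => rfl⟩
  · have hc : Nat.card G.legs = (Nat.card G.legs - 1) + 1 :=
      (Nat.sub_add_cancel Nat.card_pos).symm
    exact ⟨_, (Finite.equivFinOfCardEq hc).symm, fun _ => Equiv.bijective _,
      fun h' => (not_isEmpty_of_nonempty _ h').elim⟩

/-- A contractible graph with legs, in which every vertex has an edge, becomes an object of `Ξ` by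
choosing arbitrary orderings. -/
noncomputable def ofLegGraph (G : LegGraph.{u}) (ht : G.incidence.IsTree) (hl : G.legs.Nonempty)
    (hn : ∀ v, (G.nbhd v).Nonempty) : Xi.{u} where
  toLegGraph := G
  contractible := ht
  exists_leg := hl
  valence v := Nat.card (G.nbhd v) - 1
  ordAt v := (Finite.equivFinOfCardEq (by
    have := (hn v).to_subtype
    exact (Nat.sub_add_cancel Nat.card_pos).symm)).symm
  numLegs := (exists_ord G hl).choose
  ord := (exists_ord G hl).choose_spec.choose
  ord_bijective := (exists_ord G hl).choose_spec.choose_spec.1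
  numLegs_of_isEmpty := (exists_ord G hl).choose_spec.choose_spec.2

namespace Hom

theorem exists_vert_of_mem_image (f : Hom R S) {w : R.Vert} (hw : (f.onVert w).verts.Nonempty)
    {p : S.Edge} (hp : p ∈ f.onEdge '' R.nbhd w) : ∃ x ∈ (f.onVert w).verts, p ∈ S.nbhd x :=
  exists_vert_of_mem_edges hw (mem_edges_of_mem_boundary (f.mem_boundary_onVert.2 hp))

/-- The image of a morphism `f`: its edges are the edges in the range of `f`, and its vertices are
those vertices of the source which are not collapsed to an edge, a vertex `w` being incident to the
legs of the subgraph `f w`. -/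
def imageGraph (f : Hom R S) : LegGraph.{u} where
  Edge := Set.range f.onEdge
  Vert := {w : R.Vert // (f.onVert w).verts.Nonempty}
  finite_edge := inferInstance
  finite_vert := inferInstance
  nbhd w := {p | p.1 ∈ f.onEdge '' R.nbhd w.1}
  ncard_le_two p := by
    have hex : ∀ w : {w : R.Vert // (f.onVert w).verts.Nonempty}, ∃ x, x ∈ (f.onVert w.1).verts ∧
        (p.1 ∈ f.onEdge '' R.nbhd w.1 → p.1 ∈ S.nbhd x) := fun w => by
      by_cases hp : p.1 ∈ f.onEdge '' R.nbhd w.1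
      · obtain ⟨x, hx, hpx⟩ := f.exists_vert_of_mem_image w.2 hp
        exact ⟨x, hx, fun _ => hpx⟩
      · exact ⟨_, w.2.some_mem, fun h => (hp h).elim⟩
    choose φ hφ hφ' using hex
    refine (Set.ncard_le_ncard_of_injOn φ (fun w hw => hφ' w hw) (fun v _ w _ h => ?_)
      (Set.toFinite _)).trans (S.ncard_le_two p.1)
    exact Subtype.ext (f.eq_of_mem_onVert (hφ v) (h ▸ hφ w))

/-- The part of the image of `f` that comes from a subgraph of the source. -/
def imageNodes (f : Hom R S) (T : Subgraph R) : Set (f.imageGraph.Vert ⊕ f.imageGraph.Edge) :=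
  {x | Sum.elim (fun w => w.1 ∈ T.verts) (fun p => p.1 ∈ f.onEdge '' T.edges) x}

theorem reachable_imageNodes (f : Hom R S) (T : Subgraph R) :
    ∀ x ∈ f.imageNodes T, ∀ y ∈ f.imageNodes T, f.imageGraph.incidence.Reachable x y := by
  induction T using growth with
  | line e =>
    have h : ∀ x ∈ f.imageNodes (line e), x = .inr ⟨f.onEdge e, e, rfl⟩ := by
      rintro (w | ⟨p, hp⟩) hx
      · exact hx.elim
      · obtain ⟨c, rfl, rfl⟩ := hx
        rfl
    intro x hx y hy
    rw [h x hx, h y hy]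
  | attach T a b ha hab hb ih =>
    suffices h : ∀ x ∈ f.imageNodes (T.union (star b) (overlap_of_mem ha hab)),
        f.imageGraph.incidence.Reachable x (.inr ⟨f.onEdge a, a, rfl⟩) from
      fun x hx y hy => (h x hx).trans (h y hy).symm
    rintro (⟨w, hw⟩ | ⟨p, hp⟩) hx
    · rcases hx with hx | hx
      · exact ih (.inl ⟨w, hw⟩) hx (.inr ⟨_, _⟩) ⟨a, ha, rfl⟩
      · obtain rfl : w = b := hx
        exact SimpleGraph.Adj.reachable ⟨a, hab, rfl⟩
    · obtain ⟨e, he | he, rfl⟩ := hx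
      · exact ih (.inr ⟨_, _⟩) ⟨e, he, rfl⟩ (.inr ⟨_, _⟩) ⟨a, ha, rfl⟩
      · rcases (f.onVert b).verts.eq_empty_or_nonempty with h0 | h0
        · have h1 := eq_line_of_verts_eq_empty h0 (f.onEdge_mem (T := star b) hab)
          have h2 : f.onEdge e ∈ (line (f.onEdge a)).edges :=
            h1 ▸ f.onEdge_mem (T := star b) he
          have h3 : f.onEdge e = f.onEdge a := h2
          simp only [h3]
          exact SimpleGraph.Reachable.refl _
        · exact (SimpleGraph.Adj.reachable (v := Sum.inl ⟨b, h0⟩)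
            (show _ ∈ f.onEdge '' R.nbhd b from ⟨e, he, rfl⟩)).trans
            (SimpleGraph.Adj.reachable ⟨a, hab, rfl⟩)

theorem exists_subsingleton_neighbors (f : Hom R S) (T : Subgraph R) :
    ∀ A ⊆ f.imageNodes T, A.Nonempty → ∃ x ∈ A, ∀ y ∈ A, ∀ z ∈ A,
      f.imageGraph.incidence.Adj x y → f.imageGraph.incidence.Adj x z → y = z := by
  induction T using growth with
  | line e =>
    rintro A hA ⟨x, hx⟩
    refine ⟨x, hx, ?_⟩
    have h : ∀ x ∈ A, x = .inr ⟨f.onEdge e, e, rfl⟩ := by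
      rintro (w | ⟨p, hp⟩) hx
      · exact (hA hx).elim
      · obtain ⟨c, rfl, rfl⟩ := hA hx
        rfl
    intro y hy z hz _ _
    rw [h y hy, h z hz]
  | attach T a b ha hab hb ih =>
    intro A hA hne
    by_cases hp : ∃ p : f.imageGraph.Edge, Sum.inr p ∈ A ∧ p.1 ∉ f.onEdge '' T.edges
    · -- An edge not coming from `T` has no neighbour other than `b`.
      obtain ⟨p, hpA, hpT⟩ := hp
      have key : ∀ y ∈ A, f.imageGraph.incidence.Adj (.inr p) y → ∃ h, y = .inl ⟨b, h⟩ := by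
        rintro (⟨w, hw⟩ | q) hy hadj
        · rcases hA hy with hwT | hwb
          · exact (hpT (Set.image_mono (T.nbhd_subset w hwT) hadj)).elim
          · obtain rfl : w = b := hwb
            exact ⟨hw, rfl⟩
        · exact hadj.elim
      refine ⟨_, hpA, fun y hy z hz hxy hxz => ?_⟩
      obtain ⟨_, rfl⟩ := key y hy hxy
      obtain ⟨_, rfl⟩ := key z hz hxz
      rfl
    push Not at hp
    by_cases hbA : ∃ h, Sum.inl ⟨b, h⟩ ∈ A
    · -- The only edge at `b` coming from `T` is the image of `a`.
      obtain ⟨h, hbA⟩ := hbA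
      obtain ⟨c, -, hdis, -⟩ := f.exists_separating_edge hb
      have key : ∀ y ∈ A, f.imageGraph.incidence.Adj (.inl ⟨b, h⟩) y →
          y = .inr ⟨f.onEdge a, a, rfl⟩ := by
        rintro (w | p) hy hadj
        · exact hadj.elim
        · obtain ⟨e, he, hep⟩ := hp p hy
          obtain ⟨e', he', hep'⟩ := hadj
          refine congrArg Sum.inr (Subtype.ext ?_)
          exact eq_of_mem_edges_of_disjoint hdis (f.onEdge_mem ha)
            (f.onEdge_mem (T := star b) hab) (hep ▸ f.onEdge_mem he)
            (hep' ▸ f.onEdge_mem (T := star b) he')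
      exact ⟨_, hbA, fun y hy z hz hxy hxz => (key y hy hxy).trans (key z hz hxz).symm⟩
    · refine ih A ?_ hne
      rintro (⟨w, hw⟩ | p) hx
      · rcases hA hx with hwT | hwb
        · exact hwT
        · obtain rfl : w = b := hwb
          exact (hbA ⟨hw, hx⟩).elim
      · exact hp p hx

theorem imageGraph_isTree (f : Hom R S) : f.imageGraph.incidence.IsTree := by
  have hmem : ∀ x, x ∈ f.imageNodes (whole R) := by
    rintro (w | ⟨_, e, rfl⟩)
    exacts [Set.mem_univ w.1, ⟨e, Set.mem_univ e, rfl⟩]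
  obtain ⟨e, -⟩ := (whole R).edges_nonempty
  have : Nonempty (f.imageGraph.Vert ⊕ f.imageGraph.Edge) := ⟨.inr ⟨_, e, rfl⟩⟩
  refine ⟨⟨fun x y => f.reachable_imageNodes _ x (hmem x) y (hmem y)⟩, ?_⟩
  exact SimpleGraph.isAcyclic_of_exists_subsingleton_neighbors fun A =>
    f.exists_subsingleton_neighbors (whole R) A fun x _ => hmem x

/-- A leg of the subgraph `f R` of the target is a leg of the image. -/
theorem imageGraph_legs_nonempty (f : Hom R S) : f.imageGraph.legs.Nonempty := by
  obtain ⟨p, hp⟩ := (f.onSub (whole R)).legs_nonempty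
  have h1 := mem_boundary_of_mem_legs hp
  rw [f.boundary_onSub] at h1
  obtain ⟨e, -, rfl⟩ := Multiset.mem_map.1 h1
  refine ⟨⟨_, e, rfl⟩, ?_⟩
  rintro ⟨⟨v, hv⟩, ⟨w, hw⟩, hne, hev, hew⟩
  obtain ⟨x, hx, hex⟩ := f.exists_vert_of_mem_image hv hev
  obtain ⟨y, hy, hey⟩ := f.exists_vert_of_mem_image hw hew
  refine hp.2 ⟨x, (f.onVert_le (Set.mem_univ v)).1 hx, y, (f.onVert_le (Set.mem_univ w)).1 hy,
    ?_, hex, hey⟩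
  rintro rfl
  exact hne (Subtype.ext (f.eq_of_mem_onVert hx hy))

/-- The image of a morphism as an object of `Ξ`. -/
noncomputable def image (f : Hom R S) : Xi.{u} :=
  ofLegGraph f.imageGraph f.imageGraph_isTree f.imageGraph_legs_nonempty fun w => by
    obtain ⟨e, he⟩ := nbhd_nonempty w.1
    exact ⟨⟨_, e, rfl⟩, e, he, rfl⟩

/-- The edge of the target underlying an edge of the image. -/
def imageEdgeVal (f : Hom R S) (p : f.image.Edge) : S.Edge := Subtype.val p

/-- The vertex of the source underlying a vertex of the image. -/
def imageVertVal (f : Hom R S) (w : f.image.Vert) : R.Vert := Subtype.val w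

/-- The edge of the image to which `f` sends an edge. -/
def toImageEdge (f : Hom R S) (e : R.Edge) : f.image.Edge := ⟨f.onEdge e, Set.mem_range_self e⟩

theorem imageEdgeVal_injective (f : Hom R S) : Function.Injective f.imageEdgeVal :=
  Subtype.val_injective

theorem imageVertVal_injective (f : Hom R S) : Function.Injective f.imageVertVal :=
  Subtype.val_injective

@[simp] theorem imageEdgeVal_toImageEdge (f : Hom R S) (e : R.Edge) :
    f.imageEdgeVal (f.toImageEdge e) = f.onEdge e := rfl

theorem toImageEdge_surjective (f : Hom R S) : Function.Surjective f.toImageEdge := by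
  rintro ⟨_, e, rfl⟩
  exact ⟨e, rfl⟩

theorem mem_nbhd_image (f : Hom R S) {w : f.image.Vert} {p : f.image.Edge} :
    p ∈ f.image.nbhd w ↔ f.imageEdgeVal p ∈ f.onEdge '' R.nbhd (f.imageVertVal w) := Iff.rfl

theorem nonempty_verts_imageVertVal (f : Hom R S) (w : f.image.Vert) :
    (f.onVert (f.imageVertVal w)).verts.Nonempty := Subtype.property w

theorem map_boundary_image_star (f : Hom R S) (w : f.image.Vert) :
    (star w).boundary.map f.imageEdgeVal = (f.onVert (f.imageVertVal w)).boundary := by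
  refine (Multiset.Nodup.ext ((nodup_boundary_star w).map f.imageEdgeVal_injective)
    (nodup_boundary (f.nonempty_verts_imageVertVal w))).2 fun p => ?_
  rw [f.mem_boundary_onVert, Multiset.mem_map]
  constructor
  · rintro ⟨q, hq, rfl⟩
    exact f.mem_nbhd_image.1 (mem_boundary_star.1 hq)
  · rintro ⟨e, he, rfl⟩
    exact ⟨f.toImageEdge e, mem_boundary_star.2 (f.mem_nbhd_image.2 ⟨e, he, rfl⟩), rfl⟩

/-- The inclusion of the image into the target. -/
noncomputable def imageInclusion (f : Hom R S) : Hom f.image S :=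
  ofVert f.imageEdgeVal (fun w => f.onVert (f.imageVertVal w))
    (fun w => (f.map_boundary_image_star w).symm)
    fun _ _ hne => f.disjoint_onVert fun h => hne (f.imageVertVal_injective h)

/-- The value of the projection onto the image at a vertex `w`: the star of `w`, or an edge if `w`
is collapsed. -/
theorem exists_image_subgraph (f : Hom R S) (w : R.Vert) : ∃ A : Subgraph f.image,
    A.boundary = (star w).boundary.map f.toImageEdge ∧
      ∀ x, x ∈ A.verts ↔ f.imageVertVal x = w := by
  have hcomp : ((star w).boundary.map f.toImageEdge).map f.imageEdgeVal =
      (f.onVert w).boundary := by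
    rw [f.boundary_onVert, Multiset.map_map]
    rfl
  by_cases hw : (f.onVert w).verts.Nonempty
  · obtain ⟨w, rfl⟩ : ∃ x, f.imageVertVal x = w := ⟨⟨w, hw⟩, rfl⟩
    refine ⟨star w, ?_, fun x => f.imageVertVal_injective.eq_iff.symm⟩
    apply Multiset.map_injective f.imageEdgeVal_injective
    rw [hcomp, f.map_boundary_image_star]
  · obtain ⟨e, he⟩ := nbhd_nonempty w
    have h1 := eq_line_of_verts_eq_empty (Set.not_nonempty_iff_eq_empty.1 hw)
      (f.onEdge_mem (T := star w) he)
    refine ⟨line (f.toImageEdge e), ?_, fun x => ?_⟩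
    · apply Multiset.map_injective f.imageEdgeVal_injective
      rw [hcomp, h1]
      simp
    · refine ⟨fun h => h.elim, ?_⟩
      rintro rfl
      exact (hw (f.nonempty_verts_imageVertVal x)).elim

/-- The projection of the source onto the image. -/
noncomputable def imageProjection (f : Hom R S) : Hom R f.image :=
  ofVert f.toImageEdge (fun w => (f.exists_image_subgraph w).choose)
    (fun w => (f.exists_image_subgraph w).choose_spec.1)
    (fun v w hne => Set.disjoint_left.2 fun x hx hx' => by
      rw [(f.exists_image_subgraph v).choose_spec.2] at hx
      rw [(f.exists_image_subgraph w).choose_spec.2] at hx'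
      exact hne (hx.symm.trans hx'))

end Hom

theorem plus_imageInclusion (f : R ⟶ S) : plus (Hom.imageInclusion f : Hom.image f ⟶ S) :=
  Hom.imageEdgeVal_injective f

theorem minus_imageProjection (f : R ⟶ S) : minus (Hom.imageProjection f : R ⟶ Hom.image f) := by
  refine ⟨Hom.toImageEdge_surjective f, fun x => ⟨Hom.imageVertVal f x, ?_⟩⟩
  rw [Hom.imageProjection, Hom.onVert_ofVert, (Hom.exists_image_subgraph f _).choose_spec.2]

theorem imageProjection_comp_imageInclusion (f : R ⟶ S) :
    (Hom.imageProjection f : R ⟶ Hom.image f) ≫ (Hom.imageInclusion f : Hom.image f ⟶ S) = f :=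
  hom_ext rfl

/-- Every factorization of `f` into a morphism of `Ξ⁻` followed by one of `Ξ⁺` is isomorphic to the
factorization through the image of `f`. -/
theorem exists_iso_image {Z : Xi.{u}} (f : R ⟶ S) (h : R ⟶ Z) (g : Z ⟶ S) (hh : minus h)
    (hg : plus g) (hf : h ≫ g = f) :
    ∃ θ : Z ≅ Hom.image f, θ.hom ≫ (Hom.imageInclusion f : Hom.image f ⟶ S) = g := by
  subst hf
  have hrange : Set.range (Hom.onEdge (h ≫ g)) = Set.range (Hom.onEdge g) := by
    rw [onEdge_comp, Set.range_comp, hh.1.range_eq, Set.image_univ]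
  choose φ hφ using hh.2
  have hstar : ∀ z, Hom.onVert h (φ z) = star z := fun z => onVert_eq_star h hh (hφ z)
  have hne : ∀ z, (Hom.onVert (h ≫ g) (φ z)).verts.Nonempty := fun z => by
    rw [onVert_comp, hstar]
    exact (plus_iff g).1 hg z
  have hbij : Function.Bijective
      (fun z => (⟨φ z, hne z⟩ : {w : R.Vert // (Hom.onVert (h ≫ g) w).verts.Nonempty})) := by
    refine ⟨fun z z' hz => ?_, ?_⟩
    · have h1 := hstar z
      rw [show φ z = φ z' from congrArg Subtype.val hz, hstar z'] at h1
      exact (Set.singleton_injective (congrArg Subgraph.verts h1)).symm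
    · rintro ⟨w, x, hx⟩
      rw [onVert_comp] at hx
      obtain ⟨z, hz, -⟩ := (Hom.mem_verts_onSub g).1 hx
      exact ⟨z, Subtype.ext (Hom.eq_of_mem_onVert h (hφ z) hz)⟩
  have hnb : ∀ z e, e ∈ Z.nbhd z ↔ Hom.onEdge g e ∈ Hom.onEdge (h ≫ g) '' R.nbhd (φ z) := by
    intro z e
    rw [onEdge_comp, Set.image_comp, Function.Injective.mem_set_image hg,
      ← Hom.mem_boundary_onVert, hstar, mem_boundary_star]
  let ε : Z.Edge ≃ (Hom.image (h ≫ g)).Edge :=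
    (Equiv.ofInjective _ hg).trans (Equiv.setCongr hrange.symm)
  let ν : Z.Vert ≃ (Hom.image (h ≫ g)).Vert := Equiv.ofBijective _ hbij
  exact ⟨isoOfEquiv ε ν hnb, hom_ext rfl⟩

/-! ### Essential smallness -/

/-- A tree has shape `(n, m, N)` if its underlying graph is isomorphic to the one with edge set
`Fin n`, vertex set `Fin m` and neighbourhoods `N`. -/
def HasShape (S : Xi.{u}) (d : Σ n m : ℕ, Fin m → Set (Fin n)) : Prop :=
  ∃ (ε : S.Edge ≃ Fin d.1) (ν : S.Vert ≃ Fin d.2.1), ∀ v e, e ∈ S.nbhd v ↔ ε e ∈ d.2.2 (ν v)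

theorem exists_hasShape (S : Xi.{u}) : ∃ d, S.HasShape d :=
  ⟨⟨Nat.card S.Edge, Nat.card S.Vert, fun i =>
    Finite.equivFin S.Edge '' S.nbhd ((Finite.equivFin S.Vert).symm i)⟩,
    Finite.equivFin S.Edge, Finite.equivFin S.Vert, fun v e => by
      simp⟩

theorem HasShape.nonempty_iso {d} (hR : R.HasShape d) (hS : S.HasShape d) :
    Nonempty (R ≅ S) := by
  obtain ⟨ε, ν, h⟩ := hR
  obtain ⟨ε', ν', h'⟩ := hS
  exact ⟨isoOfEquiv (ε.trans ε'.symm) (ν.trans ν'.symm) fun v e => by simp [h, h']⟩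

instance (R S : Xi.{u}) : Finite (R ⟶ S) :=
  Finite.of_injective (fun f : R ⟶ S => Hom.onEdge f) fun _ _ h => hom_ext h

theorem essentiallySmall : EssentiallySmall.{0} Xi.{u} := by
  rw [essentiallySmall_iff]
  refine ⟨?_, ⟨fun R S => inferInstance⟩⟩
  choose d hd using exists_hasShape.{u}
  refine small_of_injective (β := Σ n m : ℕ, Fin m → Set (Fin n))
    (f := fun X : Skeleton Xi.{u} => d ((fromSkeleton _).obj X)) fun X Y hXY => ?_
  have h1 := hd ((fromSkeleton _).obj X)
  rw [show d ((fromSkeleton _).obj X) = d ((fromSkeleton _).obj Y) from hXY] at h1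
  obtain ⟨i⟩ := h1.nonempty_iso (hd _)
  exact skeleton_skeletal _ ⟨(fromSkeleton _).preimageIso i⟩

end Xi

/-- `Ξ` is an (essentially) small category, and `Ξ⁺`, `Ξ⁻` and the number of vertices make it a
dualizable generalized Reedy category. -/
theorem proposition3p4 :
    EssentiallySmall.{0} Xi.{u} ∧
      IsDualizableGeneralizedReedy Xi.plus.{u} Xi.minus.{u} Xi.degree.{u} := by
  refine ⟨Xi.essentiallySmall, ?_⟩
  exact
    { plus_wide := Xi.plus_isMultiplicative
      minus_wide := Xi.minus_isMultiplicative
      degree_lt_of_plus := fun f hf hi => (Xi.degree_le_of_plus f hf).lt_of_ne fun h =>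
        hi (Xi.isIso_of_plus_of_minus f hf (Xi.minus_of_plus_of_degree_eq f hf h))
      degree_lt_of_minus := fun f hf hi => (Xi.degree_le_of_minus f hf).lt_of_ne fun h =>
        hi (Xi.isIso_of_plus_of_minus f (Xi.plus_of_minus_of_degree_eq f hf h.symm) hf)
      degree_eq_of_isIso := fun f _ =>
        (Xi.degree_le_of_plus f (Xi.plus_of_isIso f)).antisymm
          (Xi.degree_le_of_minus f (Xi.minus_of_isIso f))
      plus_and_minus_iff := fun f => ⟨fun h => Xi.isIso_of_plus_of_minus f h.1 h.2,
        fun _ => ⟨Xi.plus_of_isIso f, Xi.minus_of_isIso f⟩⟩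
      exists_factorization := fun f => ⟨_, _, _, Xi.minus_imageProjection f,
        Xi.plus_imageInclusion f, Xi.imageProjection_comp_imageInclusion f⟩
      factorization_unique := by
        intro X Y Z Z' h g h' g' hh hg hh' hg' heq
        obtain ⟨θ, hθ⟩ := Xi.exists_iso_image (h ≫ g) h g hh hg rfl
        obtain ⟨θ', hθ'⟩ := Xi.exists_iso_image (h ≫ g) h' g' hh' hg' heq.symm
        have hθg : g = (θ ≪≫ θ'.symm).hom ≫ g' := by
          rw [Iso.trans_hom, Iso.symm_hom, Category.assoc, (Iso.inv_comp_eq θ').2 hθ'.symm, hθ]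
        refine ⟨θ ≪≫ θ'.symm, ?_, hθg⟩
        -- `g'` is a monomorphism, since it is injective on edges.
        refine Xi.hom_ext (Function.Injective.comp_left hg' ?_)
        simp only
        rw [← Xi.onEdge_comp, ← Xi.onEdge_comp, Category.assoc, ← hθg, heq]
      eq_id_of_minus := fun f θ hf h => Xi.hom_ext
        (hf.1.injective_comp_right (congrArg Xi.Hom.onEdge h))
      eq_id_of_plus := fun f θ hf h => Xi.hom_ext
        (Function.Injective.comp_left hf (congrArg Xi.Hom.onEdge h)) }
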